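/- Let $D_{1/2}$ be the parabolic cylinder function of order $1/2$, i.e. the unique solution on $\mathbb R$ of $w''+\bigl(1-\tfrac{z^2}{4}\bigr)w=0$ with $w(z)=e^{-z^2/4}z^{1/2}\bigl(1+\mathcal O(z^{-2})\bigr)$ as $z\to+\infty$. Let $-\alpha$ (with $\alpha>0$) be its unique negative zero, and put $\hat\alpha=\alpha/\sqrt2$. Write $\mathbb R_+=(0,+\infty)$, and let $\mathcal S(\overline{\mathbb R_+})$ be the space of restrictions to $[0,+\infty)$ of Schwartz functions on $\mathbb R$. There exists a real-valued function $f_*\in\mathcal S(\overline{\mathbb R_+})$ such that (i) $f_*>0$ on $\mathbb R_+$ and $f_*(0)=1$; (ii) $\displaystyle\int_{\mathbb R_+}\bigl(|f_*'(t)|^2+(t-\hat\alpha)^2|f_*(t)|^2\bigr)\,dt=\hat\alpha$; (iii) $\displaystyle\int_{\mathbb R_+}(t-\hat\alpha)|f_*(t)|^2\,dt=0$, $\displaystyle\int_{\mathbb R_+}(t-\hat\alpha)^2|f_*(t)|^2\,dt=\frac{\hat\alpha}{4}$, $\displaystyle\int_{\mathbb R_+}(t-\hat\alpha)^3|f_*(t)|^2\,dt=\frac16\bigl(1-2\hat\alpha^2\bigr)$;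 (iv) $\displaystyle\int_{\mathbb R_+}f_*'(t)f_*(t)\,dt=-\frac12$, $\displaystyle\int_{\mathbb R_+}t|f_*'(t)|^2\,dt=\frac13+\frac{\hat\alpha^2}{12}$. -/

import Mathlib

namespace ParabolicCylinder

open Real Set Filter Topology MeasureTheory Asymptotics

/-- `w` is the parabolic cylinder function `D_ν` on the real line: the solution of
`w'' + (ν + 1/2 - z²/4) w = 0` with `w(z) = e^{-z²/4} z^ν (1 + O(1/z²))` as `z → +∞`
(so that in particular `w(z) → 0`). -/
def IsParabolicCylinderD (ν : ℝ) (w : ℝ → ℝ) : Prop :=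
  Differentiable ℝ w ∧ Differentiable ℝ (deriv w) ∧
  (∀ z, deriv (deriv w) z + (ν + 1 / 2 - z ^ 2 / 4) * w z = 0) ∧
  (fun z : ℝ => w z / (exp (-z ^ 2 / 4) * z ^ ν) - 1) =O[atTop] fun z : ℝ => 1 / z ^ 2

/-! Well-posedness: `D_{1/2}` exists, is unique and has exactly one negative zero. -/

/-- Auxiliary integral, used only to show that `D_{1/2}` exists. -/
noncomputable def pcInt (p z : ℝ) : ℝ :=
  ∫ s in Ioi (0 : ℝ), s ^ p * exp (-z * s - s ^ 2 / 2)

theorem pcInt_integrableOn {p : ℝ} (hp : -1 < p) (z : ℝ) :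
    IntegrableOn (fun s : ℝ => s ^ p * exp (-z * s - s ^ 2 / 2)) (Ioi 0) := by
  have h := (integrableOn_rpow_mul_exp_neg_mul_sq (b := 1 / 4) (by norm_num) hp).const_mul
    (exp (z ^ 2))
  refine Integrable.mono' h (by fun_prop) ?_
  filter_upwards [ae_restrict_mem measurableSet_Ioi] with s hs
  have hs' : 0 < s := hs
  rw [norm_of_nonneg (by positivity)]
  have : exp (-z * s - s ^ 2 / 2) ≤ exp (z ^ 2) * exp (-(1 / 4) * s ^ 2) := by
    rw [← exp_add]
    apply exp_le_exp.2
    nlinarith [sq_nonneg (z + s / 2)]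
  calc s ^ p * exp (-z * s - s ^ 2 / 2)
      ≤ s ^ p * (exp (z ^ 2) * exp (-(1 / 4) * s ^ 2)) := by gcongr
    _ = _ := by ring

theorem pcInt_hasDerivAt {p : ℝ} (hp : -1 < p) (z : ℝ) :
    HasDerivAt (pcInt p) (-pcInt (p + 1) z) z := by
  have key := hasDerivAt_integral_of_dominated_loc_of_deriv_le
    (μ := volume.restrict (Ioi (0 : ℝ)))
    (F := fun z s : ℝ => s ^ p * exp (-z * s - s ^ 2 / 2))
    (F' := fun z s : ℝ => -(s ^ (p + 1) * exp (-z * s - s ^ 2 / 2)))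
    (bound := fun s : ℝ => s ^ (p + 1) * exp (-(-(|z| + 1)) * s - s ^ 2 / 2))
    (x₀ := z) (s := Metric.ball z 1) (Metric.ball_mem_nhds z one_pos)
    (Eventually.of_forall fun x => by fun_prop) (pcInt_integrableOn hp z) (by fun_prop)
    ?_ (pcInt_integrableOn (by linarith) _) ?_
  · have := key.2
    rw [integral_neg] at this
    exact this
  · filter_upwards [ae_restrict_mem measurableSet_Ioi] with s hs x hx
    have hs' : 0 < s := hs
    rw [norm_neg, norm_of_nonneg (by positivity)]
    have hx' : -x ≤ |z| + 1 := by
      rw [Metric.mem_ball, dist_eq] at hx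
      linarith [abs_lt.1 hx, neg_abs_le z]
    gcongr ?_ * exp (?_ - _)
    nlinarith
  · filter_upwards [ae_restrict_mem measurableSet_Ioi] with s hs x hx
    have hs' : 0 < s := hs
    have h1 : HasDerivAt (fun x : ℝ => -x * s - s ^ 2 / 2) (-s) x := by
      simpa using (((hasDerivAt_id x).neg).mul_const s).sub_const (s ^ 2 / 2)
    refine ((h1.exp).const_mul (s ^ p)).congr_deriv ?_
    rw [rpow_add_one hs'.ne']
    ring

theorem pcInt_pos {p : ℝ} (hp : -1 < p) (z : ℝ) : 0 < pcInt p z := by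
  rw [pcInt, setIntegral_pos_iff_support_of_nonneg_ae _ (pcInt_integrableOn hp z)]
  · have : Ioi (0 : ℝ) ⊆
        Function.support (fun s : ℝ => s ^ p * exp (-z * s - s ^ 2 / 2)) ∩ Ioi 0 := by
      intro s hs
      have hs' : 0 < s := hs
      exact ⟨(by positivity : 0 < s ^ p * exp (-z * s - s ^ 2 / 2)).ne', hs⟩
    exact lt_of_lt_of_le (by simp) (measure_mono this)
  · filter_upwards [ae_restrict_mem measurableSet_Ioi] with s hs
    have hs' : 0 < s := hs
    simp only [Pi.zero_apply]
    positivity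

theorem pcInt_recurrence (z : ℝ) :
    1 / 2 * pcInt (-1 / 2) z = z * pcInt (1 / 2) z + pcInt (3 / 2) z := by
  have i0 := pcInt_integrableOn (p := -1 / 2) (by norm_num) z
  have i1 := pcInt_integrableOn (p := 1 / 2) (by norm_num) z
  have i2 := pcInt_integrableOn (p := 3 / 2) (by norm_num) z
  have hd : ∀ s ∈ Ioi (0 : ℝ),
      HasDerivAt (fun s : ℝ => s ^ (1 / 2 : ℝ) * exp (-z * s - s ^ 2 / 2))
      (1 / 2 * (s ^ (-1 / 2 : ℝ) * exp (-z * s - s ^ 2 / 2))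
        - z * (s ^ (1 / 2 : ℝ) * exp (-z * s - s ^ 2 / 2))
        - s ^ (3 / 2 : ℝ) * exp (-z * s - s ^ 2 / 2)) s := by
    intro s hs
    have hs' : 0 < s := hs
    have h1 : HasDerivAt (fun s : ℝ => -z * s - s ^ 2 / 2) (-z - s) s := by
      refine (((hasDerivAt_id s).const_mul (-z)).sub
        (((hasDerivAt_id s).pow 2).div_const 2)).congr_deriv ?_
      simp
    refine ((hasDerivAt_rpow_const (p := 1 / 2) (Or.inl hs'.ne')).mul h1.exp).congr_deriv ?_
    rw [show (3 / 2 : ℝ) = 1 / 2 + 1 by norm_num, rpow_add_one hs'.ne',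
      show (1 / 2 - 1 : ℝ) = -1 / 2 by norm_num]
    ring
  have hint := ((i0.const_mul (1 / 2)).sub (i1.const_mul z)).sub i2
  have hlim := tendsto_zero_of_hasDerivAt_of_integrableOn_Ioi hd hint i1
  have hcont : ContinuousWithinAt
      (fun s : ℝ => s ^ (1 / 2 : ℝ) * exp (-z * s - s ^ 2 / 2)) (Ici 0) 0 := by
    apply ContinuousAt.continuousWithinAt
    exact (continuousAt_rpow_const _ _ (Or.inr (by norm_num))).mul (by fun_prop)
  have := integral_Ioi_of_hasDerivAt_of_tendsto hcont hd hint hlim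
  have i3 : IntegrableOn (fun s : ℝ => 1 / 2 * (s ^ (-1 / 2 : ℝ) * exp (-z * s - s ^ 2 / 2))
      - z * (s ^ (1 / 2 : ℝ) * exp (-z * s - s ^ 2 / 2))) (Ioi 0) :=
    (i0.const_mul (1 / 2)).sub (i1.const_mul z)
  rw [integral_sub i3 i2, integral_sub (i0.const_mul (1 / 2)) (i1.const_mul z), integral_const_mul,
    integral_const_mul] at this
  simp only [ne_eq, one_div, inv_eq_zero, OfNat.ofNat_ne_zero, not_false_eq_true, zero_rpow,
    zero_mul, sub_zero] at this
  simp only [pcInt, one_div]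
  linarith

/-- Auxiliary function, equal to `Γ(1/2) e^{z²/4} D_{1/2}(z)`. -/
noncomputable def pcAux (z : ℝ) : ℝ := z * pcInt (-1 / 2) z + pcInt (1 / 2) z

theorem pcAux_hasDerivAt (z : ℝ) : HasDerivAt pcAux (pcInt (-1 / 2) z / 2) z := by
  have h0 := pcInt_hasDerivAt (p := -1 / 2) (by norm_num) z
  have h1 := pcInt_hasDerivAt (p := 1 / 2) (by norm_num) z
  rw [show (-1 / 2 + 1 : ℝ) = 1 / 2 by norm_num] at h0
  rw [show (1 / 2 + 1 : ℝ) = 3 / 2 by norm_num] at h1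
  refine (((hasDerivAt_id z).mul h0).add h1).congr_deriv ?_
  have := pcInt_recurrence z
  simp only [id]
  linarith

theorem pcAux_exists_zero : ∃ z < 0, pcAux z = 0 := by
  have hm : AntitoneOn (pcInt (-1 / 2)) univ := by
    apply antitoneOn_of_deriv_nonpos convex_univ
    · exact fun x _ => (pcInt_hasDerivAt (by norm_num) x).continuousAt.continuousWithinAt
    · exact fun x _ => (pcInt_hasDerivAt (by norm_num) x).differentiableAt.differentiableWithinAt
    · intro x _
      rw [(pcInt_hasDerivAt (by norm_num) x).deriv]
      have := pcInt_pos (p := -1 / 2 + 1) (by norm_num) x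
      linarith
  have hcont : Continuous pcAux :=
    continuous_iff_continuousAt.2 fun z => (pcAux_hasDerivAt z).continuousAt
  have h0 : 0 < pcAux 0 := by simpa [pcAux] using pcInt_pos (p := 1 / 2) (by norm_num) 0
  have ha := pcInt_pos (p := -1 / 2) (by norm_num) 0
  set a := pcInt (-1 / 2) 0
  set x := -(4 * pcAux 0 / a) with hx
  have hx0 : x < 0 := by rw [hx]; linarith [show 0 < 4 * pcAux 0 / a by positivity]
  obtain ⟨c, hc, hc'⟩ := exists_hasDerivAt_eq_slope pcAux (fun z => pcInt (-1 / 2) z / 2) hx0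
    hcont.continuousOn (fun z _ => pcAux_hasDerivAt z)
  have hca : a ≤ pcInt (-1 / 2) c := hm (mem_univ _) (mem_univ _) hc.2.le
  rw [eq_div_iff (by linarith)] at hc'
  have hxa : -x * a = 4 * pcAux 0 := by rw [hx]; field_simp
  have hneg : pcAux x < 0 := by nlinarith
  obtain ⟨z, hz, hz'⟩ := intermediate_value_Icc hx0.le hcont.continuousOn
    (show (0 : ℝ) ∈ Icc _ _ from ⟨hneg.le, h0.le⟩)
  refine ⟨z, lt_of_le_of_ne hz.2 ?_, hz'⟩
  rintro rfl
  linarith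

theorem pcAux_strictMono : StrictMono pcAux :=
  strictMono_of_deriv_pos fun z => by
    rw [(pcAux_hasDerivAt z).deriv]
    have := pcInt_pos (p := -1 / 2) (by norm_num) z
    positivity

theorem pcAux_deriv_hasDerivAt (z : ℝ) :
    HasDerivAt (fun z => pcInt (-1 / 2) z / 2) (-pcInt (1 / 2) z / 2) z := by
  have h0 := pcInt_hasDerivAt (p := -1 / 2) (by norm_num) z
  rw [show (-1 / 2 + 1 : ℝ) = 1 / 2 by norm_num] at h0
  exact h0.div_const 2

theorem pcInt_asymp (z : ℝ) (hz : 0 < z) :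
    |pcAux z - Gamma (1 / 2) * z ^ (1 / 2 : ℝ)|
      ≤ (Gamma (5 / 2) / 2 + Gamma (3 / 2)) * (z ^ (1 / 2 : ℝ) * (1 / z ^ 2)) := by
  have hg : ∀ a : ℝ, 0 < a →
      IntegrableOn (fun s : ℝ => s ^ (a - 1) * exp (-(z * s))) (Ioi 0) := fun a ha =>
    .of_integral_ne_zero (by
      rw [integral_rpow_mul_exp_neg_mul_Ioi ha hz]
      have := Gamma_pos_of_pos ha
      positivity)
  have i0 := pcInt_integrableOn (p := -1 / 2) (by norm_num) z
  have i1 := pcInt_integrableOn (p := 1 / 2) (by norm_num) z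
  have g1 := integral_rpow_mul_exp_neg_mul_Ioi (a := 1 / 2) (by norm_num) hz
  have g3 := integral_rpow_mul_exp_neg_mul_Ioi (a := 3 / 2) (by norm_num) hz
  have g5 := integral_rpow_mul_exp_neg_mul_Ioi (a := 5 / 2) (by norm_num) hz
  have j1 := hg (1 / 2) (by norm_num)
  have j3 := hg (3 / 2) (by norm_num)
  have j5 := hg (5 / 2) (by norm_num)
  rw [show (1 / 2 - 1 : ℝ) = -1 / 2 by norm_num] at g1 j1
  rw [show (3 / 2 - 1 : ℝ) = 1 / 2 by norm_num] at g3 j3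
  rw [show (5 / 2 - 1 : ℝ) = 3 / 2 by norm_num] at g5 j5
  have hB : pcInt (1 / 2) z ≤ (1 / z) ^ (3 / 2 : ℝ) * Gamma (3 / 2) := by
    rw [← g3]
    refine setIntegral_mono_on i1 j3 measurableSet_Ioi fun s hs => ?_
    have hs' : 0 < s := hs
    gcongr
    nlinarith [sq_nonneg s]
  have hA : pcInt (-1 / 2) z ≤ (1 / z) ^ (1 / 2 : ℝ) * Gamma (1 / 2) := by
    rw [← g1]
    refine setIntegral_mono_on i0 j1 measurableSet_Ioi fun s hs => ?_
    have hs' : 0 < s := hs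
    gcongr
    nlinarith [sq_nonneg s]
  have hA' : (1 / z) ^ (1 / 2 : ℝ) * Gamma (1 / 2)
      - 1 / 2 * ((1 / z) ^ (5 / 2 : ℝ) * Gamma (5 / 2)) ≤ pcInt (-1 / 2) z := by
    rw [← g1, ← g5, ← integral_const_mul, ← integral_sub j1 (j5.const_mul _)]
    refine setIntegral_mono_on (j1.sub (j5.const_mul _)) i0 measurableSet_Ioi fun s hs => ?_
    have hs' : 0 < s := hs
    have e1 : s ^ (3 / 2 : ℝ) = s ^ (-1 / 2 : ℝ) * s ^ 2 := by
      rw [← rpow_two, ← rpow_add hs']; norm_num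
    have e2 : exp (-z * s - s ^ 2 / 2) = exp (-(z * s)) * exp (-(s ^ 2 / 2)) := by
      rw [← exp_add]; ring_nf
    have e3 := add_one_le_exp (-(s ^ 2 / 2))
    rw [e1, e2]
    have : 0 < s ^ (-1 / 2 : ℝ) * exp (-(z * s)) := by positivity
    nlinarith [mul_le_mul_of_nonneg_left e3 this.le]
  have hB0 := pcInt_pos (p := 1 / 2) (by norm_num) z
  have p1 : z * (1 / z) ^ (1 / 2 : ℝ) = z ^ (1 / 2 : ℝ) := by
    rw [one_div, inv_rpow hz.le, ← rpow_neg hz.le, ← rpow_one_add' hz.le] <;> norm_num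
  have p3 : (1 / z) ^ (3 / 2 : ℝ) = z ^ (1 / 2 : ℝ) * (1 / z ^ 2) := by
    rw [one_div z, inv_rpow hz.le, ← rpow_neg hz.le, one_div (z ^ 2), ← rpow_two,
      ← rpow_neg hz.le, ← rpow_add hz]; norm_num
  have p5 : z * (1 / z) ^ (5 / 2 : ℝ) = z ^ (1 / 2 : ℝ) * (1 / z ^ 2) := by
    rw [one_div z, inv_rpow hz.le, ← rpow_neg hz.le, one_div (z ^ 2), ← rpow_two,
      ← rpow_neg hz.le, ← rpow_add hz, ← rpow_one_add' hz.le] <;> norm_num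
  have q1 := mul_le_mul_of_nonneg_left hA hz.le
  have q2 := mul_le_mul_of_nonneg_left hA' hz.le
  rw [← mul_assoc, p1] at q1
  rw [mul_sub, ← mul_assoc, p1, mul_left_comm, ← mul_assoc z, p5] at q2
  rw [p3] at hB
  have r3 := Gamma_pos_of_pos (show (0 : ℝ) < 3 / 2 by norm_num)
  have r5 := Gamma_pos_of_pos (show (0 : ℝ) < 5 / 2 by norm_num)
  have hQ : 0 < z ^ (1 / 2 : ℝ) * (1 / z ^ 2) := by positivity
  have := mul_pos hQ r3
  have := mul_pos hQ r5
  rw [pcAux, abs_le]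
  constructor <;> nlinarith

theorem isParabolicCylinderD_half :
    IsParabolicCylinderD (1 / 2) fun z => exp (-z ^ 2 / 4) * pcAux z / Gamma (1 / 2) := by
  have hG : 0 < Gamma (1 / 2) := Gamma_pos_of_pos (by norm_num)
  have he : ∀ z : ℝ, HasDerivAt (fun z : ℝ => exp (-z ^ 2 / 4)) (-(z / 2) * exp (-z ^ 2 / 4)) z := by
    intro z
    have h1 : HasDerivAt (fun z : ℝ => -z ^ 2 / 4) (-(z / 2)) z := by
      refine (((hasDerivAt_id z).pow 2).neg.div_const 4).congr_deriv ?_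
      simp only [id]
      norm_num
      ring
    exact h1.exp.congr_deriv (by ring)
  have h1 : ∀ z, HasDerivAt (fun z => exp (-z ^ 2 / 4) * pcAux z / Gamma (1 / 2))
      (exp (-z ^ 2 / 4) * (pcInt (-1 / 2) z / 2 - z / 2 * pcAux z) / Gamma (1 / 2)) z := by
    intro z
    exact (((he z).mul (pcAux_hasDerivAt z)).div_const _).congr_deriv (by ring)
  have hd1 : deriv (fun z => exp (-z ^ 2 / 4) * pcAux z / Gamma (1 / 2)) = fun z =>
      exp (-z ^ 2 / 4) * (pcInt (-1 / 2) z / 2 - z / 2 * pcAux z) / Gamma (1 / 2) :=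
    funext fun z => (h1 z).deriv
  have h2 : ∀ z, HasDerivAt
      (fun z => exp (-z ^ 2 / 4) * (pcInt (-1 / 2) z / 2 - z / 2 * pcAux z) / Gamma (1 / 2))
      ((z ^ 2 / 4 - 1) * (exp (-z ^ 2 / 4) * pcAux z / Gamma (1 / 2))) z := by
    intro z
    refine (((he z).mul ((pcAux_deriv_hasDerivAt z).sub
      (((hasDerivAt_id z).div_const 2).mul (pcAux_hasDerivAt z)))).div_const _).congr_deriv ?_
    simp only [id, Pi.sub_apply, Pi.mul_apply, pcAux]
    ring
  refine ⟨fun z => (h1 z).differentiableAt, ?_, ?_, ?_⟩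
  · rw [hd1]
    exact fun z => (h2 z).differentiableAt
  · intro z
    rw [hd1, (h2 z).deriv]
    ring
  · refine IsBigO.of_bound ((Gamma (5 / 2) / 2 + Gamma (3 / 2)) / Gamma (1 / 2)) ?_
    filter_upwards [eventually_gt_atTop 0] with z hz
    have hp : 0 < z ^ (1 / 2 : ℝ) := by positivity
    have e : exp (-z ^ 2 / 4) * pcAux z / Gamma (1 / 2) / (exp (-z ^ 2 / 4) * z ^ (1 / 2 : ℝ)) - 1
        = (pcAux z - Gamma (1 / 2) * z ^ (1 / 2 : ℝ)) / (Gamma (1 / 2) * z ^ (1 / 2 : ℝ)) := by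
      have := exp_pos (-z ^ 2 / 4)
      field_simp
    rw [e, norm_eq_abs, norm_of_nonneg (by positivity), abs_div,
      abs_of_pos (show 0 < Gamma (1 / 2) * z ^ (1 / 2 : ℝ) by positivity),
      div_le_iff₀ (by positivity)]
    refine (pcInt_asymp z hz).trans (le_of_eq ?_)
    field_simp

theorem IsParabolicCylinderD.unique {ν : ℝ} {w v : ℝ → ℝ} (hw : IsParabolicCylinderD ν w)
    (hv : IsParabolicCylinderD ν v) : w = v := by
  obtain ⟨hw1, hw2, hw3, hw4⟩ := hw
  obtain ⟨hv1, hv2, hv3, hv4⟩ := hv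
  have hdw : ∀ z, HasDerivAt w (deriv w z) z := fun z => (hw1 z).hasDerivAt
  have hdv : ∀ z, HasDerivAt v (deriv v z) z := fun z => (hv1 z).hasDerivAt
  have hdw' : ∀ z, HasDerivAt (deriv w) (-(ν + 1 / 2 - z ^ 2 / 4) * w z) z := fun z =>
    (hw2 z).hasDerivAt.congr_deriv (by linarith [hw3 z])
  have hdv' : ∀ z, HasDerivAt (deriv v) (-(ν + 1 / 2 - z ^ 2 / 4) * v z) z := fun z =>
    (hv2 z).hasDerivAt.congr_deriv (by linarith [hv3 z])
  -- the Wronskian is constant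
  obtain ⟨c, hc⟩ : ∃ c, ∀ z, w z * deriv v z - deriv w z * v z = c := by
    refine ⟨w 0 * deriv v 0 - deriv w 0 * v 0, fun z => ?_⟩
    have hW : ∀ z, HasDerivAt (fun z => w z * deriv v z - deriv w z * v z) 0 z := fun z =>
      (((hdw z).mul (hdv' z)).sub ((hdw' z).mul (hdv z))).congr_deriv (by ring)
    exact is_const_of_deriv_eq_zero (fun z => (hW z).differentiableAt) (fun z => (hW z).deriv) z 0
  have hlim0 : Tendsto (fun z : ℝ => 1 / z ^ 2) atTop (𝓝 0) := by
    simp_rw [one_div]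
    exact (tendsto_pow_atTop (two_ne_zero)).inv_tendsto_atTop
  have hlw := hw4.trans_tendsto hlim0
  have hlv := hv4.trans_tendsto hlim0
  have hlE : Tendsto (fun z : ℝ => exp (-z ^ 2 / 4) * z ^ ν) atTop (𝓝 0) := by
    have h1 := rpow_mul_exp_neg_mul_sq_isLittleO_exp_neg (b := 1 / 4) (by norm_num) ν
    have h2 : Tendsto (fun z : ℝ => exp (-(1 / 2) * z)) atTop (𝓝 0) :=
      tendsto_exp_atBot.comp (tendsto_id.const_mul_atTop_of_neg (by norm_num))
    refine (h1.trans_tendsto h2).congr fun z => ?_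
    rw [mul_comm]
    ring_nf
  have hlq : Tendsto (fun z => w z / v z) atTop (𝓝 1) := by
    have := (hlw.add_const 1).div (hlv.add_const 1) (by norm_num)
    simp only [zero_add, div_one] at this
    refine this.congr' ?_
    filter_upwards [eventually_gt_atTop 0] with z hz
    have : 0 < exp (-z ^ 2 / 4) * z ^ ν := by positivity
    simp only [Pi.div_apply, sub_add_cancel]
    rw [div_div_div_cancel_right₀ this.ne']
  have hlv0 : Tendsto v atTop (𝓝 0) := by
    have := (hlv.add_const 1).mul hlE
    simp only [zero_add, one_mul] at this
    refine this.congr' ?_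
    filter_upwards [eventually_gt_atTop 0] with z hz
    have : 0 < exp (-z ^ 2 / 4) * z ^ ν := by positivity
    rw [sub_add_cancel, div_mul_cancel₀ _ this.ne']
  have hev : ∀ᶠ z in atTop, 0 < v z ∧ v z < 1 ∧ |w z / v z - 1| < 1 := by
    filter_upwards [hlv.eventually (lt_mem_nhds (show (-1 : ℝ) < 0 by norm_num)),
      hlv0.eventually (gt_mem_nhds (show (0 : ℝ) < 1 by norm_num)),
      hlq.eventually (Metric.ball_mem_nhds 1 one_pos), eventually_gt_atTop 0] with z h1 h2 h3 hz
    have hE : 0 < exp (-z ^ 2 / 4) * z ^ ν := by positivity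
    refine ⟨?_, h2, h3⟩
    have : 0 < v z / (exp (-z ^ 2 / 4) * z ^ ν) := by linarith
    exact (div_pos_iff_of_pos_right hE).1 this
  obtain ⟨Z, hZ⟩ := eventually_atTop.1 hev
  have hmvt : ∀ z, Z < z → ∃ ξ, Z ≤ ξ ∧ -c / v ξ ^ 2 * (z - Z) = w z / v z - w Z / v Z := by
    intro z hz
    have hd : ∀ x, Z ≤ x → HasDerivAt (fun z => w z / v z) (-c / v x ^ 2) x := fun x hx =>
      ((hdw x).div (hdv x) (hZ x hx).1.ne').congr_deriv (by rw [← hc x]; ring)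
    obtain ⟨ξ, hξ, h⟩ := exists_hasDerivAt_eq_slope (fun z => w z / v z) _ hz
      (fun x hx => (hd x hx.1).continuousAt.continuousWithinAt) (fun x hx => hd x hx.1.le)
    exact ⟨ξ, hξ.1.le, by rw [h, div_mul_cancel₀]; linarith⟩
  have hc0 : c = 0 := by
    by_contra hne
    have hcp : 0 < |c| := abs_pos.2 hne
    have hlt : Z < Z + 2 / |c| := by linarith [show 0 < 2 / |c| by positivity]
    obtain ⟨ξ, hξ, h⟩ := hmvt _ hlt
    have h1 := abs_lt.1 (hZ Z le_rfl).2.2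
    have h2 := abs_lt.1 (hZ _ hlt.le).2.2
    have h3 : |(-c / v ξ ^ 2 * (Z + 2 / |c| - Z))| < 2 := by
      rw [h, abs_lt]
      constructor <;> linarith
    obtain ⟨h4, h5, -⟩ := hZ ξ hξ
    have hsq : v ξ ^ 2 ≤ 1 := by nlinarith
    have h6 : |(-c / v ξ ^ 2 * (Z + 2 / |c| - Z))| = 2 / v ξ ^ 2 := by
      rw [add_sub_cancel_left, abs_mul, abs_div, abs_neg, abs_of_pos (pow_pos h4 2),
        abs_of_pos (show 0 < 2 / |c| by positivity)]
      field_simp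
    rw [h6, div_lt_iff₀ (pow_pos h4 2)] at h3
    linarith
  subst hc0
  have hq : ∀ z, Z < z → w z / v z = w Z / v Z := fun z hz => by
    obtain ⟨ξ, -, h⟩ := hmvt z hz
    simp only [neg_zero, zero_div, zero_mul] at h
    linarith
  have hq1 : w Z / v Z = 1 :=
    tendsto_nhds_unique (tendsto_const_nhds.congr' (by
      filter_upwards [eventually_gt_atTop Z] with z hz using (hq z hz).symm)) hlq
  have heq : ∀ z, Z < z → w z = v z := fun z hz => by
    have := hq z hz
    rwa [hq1, div_eq_one_iff_eq (hZ z hz.le).1.ne'] at this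
  have hee : w =ᶠ[𝓝 (Z + 1)] v := by
    filter_upwards [lt_mem_nhds (show Z < Z + 1 by linarith)] with z hz using heq z hz
  funext x
  set R := |x| + |Z + 1| + 1 with hR
  have hRx : x ∈ Icc (-R) R := by
    rw [mem_Icc]
    constructor <;> linarith [neg_abs_le x, le_abs_self x, abs_nonneg (Z + 1)]
  have hRZ : Z + 1 ∈ Ioo (-R) R := by
    rw [mem_Ioo]
    constructor <;> linarith [neg_abs_le (Z + 1), le_abs_self (Z + 1), abs_nonneg x]
  have hK : (0 : ℝ) ≤ 1 + |ν + 1 / 2| + R ^ 2 := by positivity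
  have key := ODE_solution_unique_of_mem_Icc
    (v := fun t (y : ℝ × ℝ) => (y.2, -(ν + 1 / 2 - t ^ 2 / 4) * y.1)) (s := fun _ => univ)
    (K := ⟨1 + |ν + 1 / 2| + R ^ 2, hK⟩) (f := fun t => (w t, deriv w t))
    (g := fun t => (v t, deriv v t)) ?_ hRZ
    (fun t _ => ((hdw t).prodMk (hdw' t)).continuousAt.continuousWithinAt)
    (fun t _ => (hdw t).prodMk (hdw' t)) (fun _ _ => mem_univ _)
    (fun t _ => ((hdv t).prodMk (hdv' t)).continuousAt.continuousWithinAt)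
    (fun t _ => (hdv t).prodMk (hdv' t)) (fun _ _ => mem_univ _)
    (by simp only [hee.eq_of_nhds, hee.deriv_eq])
  · exact congrArg Prod.fst (key hRx)
  · intro t ht
    refine (LipschitzWith.of_dist_le_mul fun y y' => ?_).lipschitzOnWith
    have hab : |-(ν + 1 / 2 - t ^ 2 / 4)| ≤ |ν + 1 / 2| + R ^ 2 := by
      have ht2 : t ^ 2 ≤ R ^ 2 := sq_le_sq' ht.1.le ht.2.le
      rw [abs_neg]
      refine (abs_sub _ _).trans ?_
      rw [abs_of_nonneg (show 0 ≤ t ^ 2 / 4 by positivity)]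
      nlinarith [sq_nonneg t]
    have d1 : |y.1 - y'.1| ≤ dist y y' := le_max_left _ _
    have d2 : |y.2 - y'.2| ≤ dist y y' := le_max_right _ _
    rw [Prod.dist_eq (x := (y.2, _)), max_le_iff]
    simp only [dist_eq]
    change _ ≤ (1 + |ν + 1 / 2| + R ^ 2) * _ ∧ _ ≤ (1 + |ν + 1 / 2| + R ^ 2) * _
    constructor
    · nlinarith [abs_nonneg (ν + 1 / 2), sq_nonneg R, dist_nonneg (x := y) (y := y')]
    · rw [← mul_sub, abs_mul]
      have := mul_le_mul hab d1 (abs_nonneg _) (by positivity)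
      nlinarith [dist_nonneg (x := y) (y := y')]

theorem existsUnique_parabolicCylinderD_half : ∃! w : ℝ → ℝ, IsParabolicCylinderD (1 / 2) w :=
  ⟨_, isParabolicCylinderD_half, fun _ h => h.unique isParabolicCylinderD_half⟩

/-- The parabolic cylinder function `D_{1/2}` on the real line. -/
noncomputable def parabolicCylinderDHalf : ℝ → ℝ :=
  existsUnique_parabolicCylinderD_half.choose

theorem parabolicCylinderDHalf_eq : parabolicCylinderDHalf =
    fun z => exp (-z ^ 2 / 4) * pcAux z / Gamma (1 / 2) :=
  existsUnique_parabolicCylinderD_half.choose_spec.1.unique isParabolicCylinderD_half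

theorem existsUnique_alpha : ∃! α : ℝ, 0 < α ∧ parabolicCylinderDHalf (-α) = 0 := by
  have hiff : ∀ z, parabolicCylinderDHalf z = 0 ↔ pcAux z = 0 := fun z => by
    have hG : Gamma (1 / 2) ≠ 0 := (Gamma_pos_of_pos (by norm_num)).ne'
    rw [parabolicCylinderDHalf_eq, div_eq_zero_iff, mul_eq_zero]
    simp only [(exp_pos _).ne', hG, false_or, or_false]
  simp_rw [hiff]
  obtain ⟨z, hz, hz'⟩ := pcAux_exists_zero
  refine ⟨-z, ⟨by linarith, by simpa using hz'⟩, fun y hy => ?_⟩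
  have := pcAux_strictMono.injective (hy.2.trans hz'.symm)
  linarith

/-- The positive number `α` such that `-α` is the unique negative zero of `D_{1/2}`. -/
noncomputable def alpha : ℝ := existsUnique_alpha.choose

/-- The constant `α̂ = α / √2`. -/
noncomputable def alphaHat : ℝ := alpha / √2

end ParabolicCylinder

namespace ParabolicCylinder

open Real Set Filter Topology MeasureTheory Asymptotics Polynomial
open scoped ContDiff

/-! The function is `f(t) = D_{-1/2}(√2 (t - α̂))`, normalised to equal `1` at `0`. Three properties
suffice. It solves `f'' = (t - α̂)² f`. It is positive, because up to a positive factor `D_{-1/2}`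
is the integral of a positive function (`pcInt (-1/2)`). It satisfies the Robin condition `f'(0) =
-α̂ f(0)`: the ladder relation `D_{1/2}(z) = (z/2) D_{-1/2}(z) - D_{-1/2}'(z)` turns the zero of
`D_{1/2}` at `-α` into this condition (`pcGaussDeriv_neg_alphaHat`).

Every integral then follows without further knowledge of `f`. For polynomials `P`, `Q`, `R`, the
derivative of `P f² + Q f f' + R f'²` is again a quadratic form in `(f, f')` with polynomial
coefficients, since `f''` is eliminated by the equation. Each required integrand is such a
derivative, so by decay its integral is minus the boundary term at `0`
(`integral_deriv_quadratic_form`), and `f(0) = 1`, `f'(0) = -α̂` make that term explicit.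

The Schwartz property rests on the same closure: each derivative of `f` has the form `P f + Q f'`,
and the Gaussian factor in `f` and `f'` beats any polynomial (`exists_schwartzMap_eqOn_Ici`). -/

/-- A polynomial is dominated by the exponential at `+∞`. -/
theorem eval_isBigO_exp (P : ℝ[X]) : (fun t => P.eval t) =O[atTop] fun t : ℝ => exp t :=
  (isLittleO_of_tendsto (fun t h => absurd h (exp_pos t).ne') P.tendsto_div_exp_atTop).isBigO

/-! ### Decaying solutions of `f'' = q f` with `q` a polynomial -/

section LinearODE

variable {f f' : ℝ → ℝ} {q : ℝ[X]}

/-- The combinations `P f + Q f'` with polynomial coefficients are closed under differentiation.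
Both smoothness and the shape of all higher derivatives follow by induction from this. -/
theorem hasDerivAt_linear_form (hf : ∀ t, HasDerivAt f (f' t) t)
    (hf' : ∀ t, HasDerivAt f' (q.eval t * f t) t) (P Q : ℝ[X]) (t : ℝ) :
    HasDerivAt (fun t => P.eval t * f t + Q.eval t * f' t)
      ((derivative P + Q * q).eval t * f t + (P + derivative Q).eval t * f' t) t := by
  refine (((P.hasDerivAt t).mul (hf t)).add ((Q.hasDerivAt t).mul (hf' t))).congr_deriv ?_
  simp only [eval_add, eval_mul]
  ring

theorem contDiff_linear_form (hf : ∀ t, HasDerivAt f (f' t) t)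
    (hf' : ∀ t, HasDerivAt f' (q.eval t * f t) t) (n : ℕ) (P Q : ℝ[X]) :
    ContDiff ℝ n (fun t => P.eval t * f t + Q.eval t * f' t) := by
  induction n generalizing P Q with
  | zero =>
    exact contDiff_zero.2 (continuous_iff_continuousAt.2 fun t =>
      (hasDerivAt_linear_form hf hf' P Q t).continuousAt)
  | succ n ih =>
    push_cast
    refine contDiff_succ_iff_deriv.2
      ⟨fun t => (hasDerivAt_linear_form hf hf' P Q t).differentiableAt, by simp, ?_⟩
    rw [funext fun t => (hasDerivAt_linear_form hf hf' P Q t).deriv]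
    exact ih _ _

theorem exists_iteratedDeriv_linear_form (hf : ∀ t, HasDerivAt f (f' t) t)
    (hf' : ∀ t, HasDerivAt f' (q.eval t * f t) t) (n : ℕ) :
    ∃ P Q : ℝ[X], iteratedDeriv n f = fun t => P.eval t * f t + Q.eval t * f' t := by
  induction n with
  | zero => exact ⟨1, 0, by simp⟩
  | succ n ih =>
    obtain ⟨P, Q, h⟩ := ih
    refine ⟨derivative P + Q * q, P + derivative Q, ?_⟩
    rw [iteratedDeriv_succ, h]
    exact funext fun t => (hasDerivAt_linear_form hf hf' P Q t).deriv

theorem contDiff_of_linear_ode (hf : ∀ t, HasDerivAt f (f' t) t)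
    (hf' : ∀ t, HasDerivAt f' (q.eval t * f t) t) : ContDiff ℝ ∞ f :=
  contDiff_infty.2 fun n => by simpa using contDiff_linear_form hf hf' n 1 0

/-- A solution of `f'' = q f`, with `q` a polynomial, that decays exponentially at `+∞` together
with its derivative is on `[0, +∞)` the restriction of a Schwartz function. -/
theorem exists_schwartzMap_eqOn_Ici (hf : ∀ t, HasDerivAt f (f' t) t)
    (hf' : ∀ t, HasDerivAt f' (q.eval t * f t) t) (hd : f =O[atTop] fun t : ℝ => exp (-2 * t))
    (hd' : f' =O[atTop] fun t : ℝ => exp (-2 * t)) :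
    ∃ F : SchwartzMap ℝ ℝ, EqOn F f (Ici 0) := by
  -- Nothing is known about decay at `-∞`, so `f` is cut off smoothly: the factor is `1` for `t ≥ 0`
  -- and `0` for `t ≤ -1`.
  set G : ℝ → ℝ := fun t => smoothTransition (t + 1) * f t with hG
  have hGf : ∀ t, 0 ≤ t → G t = f t := fun t ht => by
    simp [hG, smoothTransition.one_of_one_le (show 1 ≤ t + 1 by linarith)]
  have hG0 : ∀ t, t ≤ -1 → G t = 0 := fun t ht => by
    simp [hG, smoothTransition.zero_of_nonpos (show t + 1 ≤ 0 by linarith)]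
  have hGs : ContDiff ℝ ∞ G :=
    (smoothTransition.contDiff.comp (contDiff_id.add contDiff_const)).mul
      (contDiff_of_linear_ode hf hf')
  have hbd : ∀ k n : ℕ, ∃ C, ∀ t, ‖t‖ ^ k * ‖iteratedFDeriv ℝ n G t‖ ≤ C := by
    intro k n
    simp_rw [norm_iteratedFDeriv_eq_norm_iteratedDeriv, ← norm_pow, ← norm_mul]
    obtain ⟨P, Q, hPQ⟩ := exists_iteratedDeriv_linear_form hf hf' n
    -- Near `+∞` the derivative is `P f + Q f'`. The polynomial factors cost at most `e^t` against
    -- the rate `e^{-2t}`, so `e^{-t}` remains, which is bounded.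
    have hO : (fun t => t ^ k * iteratedDeriv n G t) =O[atTop] fun _ : ℝ => (1 : ℝ) := by
      have h1 := ((eval_isBigO_exp (X ^ k * P)).mul hd).add
        ((eval_isBigO_exp (X ^ k * Q)).mul hd')
      refine (h1.congr' ?_ .rfl).trans ?_
      · filter_upwards [eventually_gt_atTop 0] with t ht
        have : G =ᶠ[𝓝 t] f := by
          filter_upwards [lt_mem_nhds ht] with s hs using hGf s hs.le
        rw [(this.iteratedDeriv n).eq_of_nhds, hPQ]
        simp only [eval_mul, eval_pow, eval_X]
        ring
      · refine IsBigO.of_bound 1 ?_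
        filter_upwards [eventually_ge_atTop 0] with t ht
        rw [← exp_add, norm_of_nonneg (exp_pos _).le]
        rw [norm_one, mul_one, exp_le_one_iff]
        linarith
    obtain ⟨C, hC⟩ := hO.bound
    obtain ⟨T, hT⟩ := eventually_atTop.1 hC
    have hcont : Continuous fun t => t ^ k * iteratedDeriv n G t :=
      (continuous_pow k).mul (hGs.continuous_iteratedDeriv n (by exact_mod_cast le_top))
    -- On the middle range compactness gives the bound. Starting at `-2` rather than `-1` ensures
    -- that `G` vanishes in a whole neighbourhood of each point further left, so its derivatives
    -- vanish there too.
    obtain ⟨D, hD⟩ := isCompact_Icc.exists_bound_of_continuousOn (s := Icc (-2) T)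
      hcont.continuousOn
    refine ⟨max (max C D) 0, fun t => ?_⟩
    rcases lt_or_ge t (-2) with h | h
    · have : G =ᶠ[𝓝 t] fun _ => 0 := by
        filter_upwards [gt_mem_nhds h] with s hs using hG0 s (by linarith)
      rw [(this.iteratedDeriv n).eq_of_nhds]
      simp
    rcases le_or_gt t T with h' | h'
    · exact (hD t ⟨h, h'⟩).trans ((le_max_right _ _).trans (le_max_left _ _))
    · have := hT t h'.le
      simp only [norm_one, mul_one] at this
      exact this.trans ((le_max_left _ _).trans (le_max_left _ _))
  exact ⟨⟨G, hGs, hbd⟩, fun t ht => hGf t ht⟩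

/-- Serves twice: it makes the differentiated form integrable on the half-line, and it makes the
form itself vanish at `+∞`. -/
theorem quadratic_form_isBigO (hd : f =O[atTop] fun t : ℝ => exp (-2 * t))
    (hd' : f' =O[atTop] fun t : ℝ => exp (-2 * t)) (P Q R : ℝ[X]) :
    (fun t => P.eval t * f t ^ 2 + Q.eval t * (f t * f' t) + R.eval t * f' t ^ 2)
      =O[atTop] fun t : ℝ => exp (-1 * t) := by
  have h : (fun t : ℝ => exp t * (exp (-2 * t) * exp (-2 * t)))
      =O[atTop] fun t : ℝ => exp (-1 * t) := by
    refine IsBigO.of_bound 1 ?_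
    filter_upwards [eventually_ge_atTop 0] with t ht
    rw [← exp_add, ← exp_add, norm_of_nonneg (exp_pos _).le, norm_of_nonneg (exp_pos _).le, one_mul]
    exact exp_le_exp.2 (by linarith)
  refine IsBigO.trans ?_ h
  simp_rw [sq]
  exact (((eval_isBigO_exp P).mul (hd.mul hd)).add ((eval_isBigO_exp Q).mul (hd.mul hd'))).add
    ((eval_isBigO_exp R).mul (hd'.mul hd'))

/-- The integral over `(0, +∞)` of the derivative of `P f² + Q f f' + R f'²`, where `f'' = q f`
and `f`, `f'` decay exponentially. -/
theorem integral_deriv_quadratic_form (hf : ∀ t, HasDerivAt f (f' t) t)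
    (hf' : ∀ t, HasDerivAt f' (q.eval t * f t) t) (hd : f =O[atTop] fun t : ℝ => exp (-2 * t))
    (hd' : f' =O[atTop] fun t : ℝ => exp (-2 * t)) (P Q R : ℝ[X]) :
    ∫ t in Ioi (0 : ℝ), ((derivative P + Q * q).eval t * f t ^ 2
        + (2 * P + derivative Q + 2 * R * q).eval t * (f t * f' t)
        + (Q + derivative R).eval t * f' t ^ 2)
      = -(P.eval 0 * f 0 ^ 2 + Q.eval 0 * (f 0 * f' 0) + R.eval 0 * f' 0 ^ 2) := by
  have hder : ∀ t ∈ Ici (0 : ℝ), HasDerivAt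
      (fun t => P.eval t * f t ^ 2 + Q.eval t * (f t * f' t) + R.eval t * f' t ^ 2)
      ((derivative P + Q * q).eval t * f t ^ 2
        + (2 * P + derivative Q + 2 * R * q).eval t * (f t * f' t)
        + (Q + derivative R).eval t * f' t ^ 2) t := by
    intro t _
    refine ((((P.hasDerivAt t).mul ((hf t).pow 2)).add
      ((Q.hasDerivAt t).mul ((hf t).mul (hf' t)))).add
      ((R.hasDerivAt t).mul ((hf' t).pow 2))).congr_deriv ?_
    simp only [eval_add, eval_mul, Pi.mul_apply, Pi.pow_apply, eval_ofNat]
    push_cast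
    ring
  have hcf : Continuous f := continuous_iff_continuousAt.2 fun t => (hf t).continuousAt
  have hcf' : Continuous f' := continuous_iff_continuousAt.2 fun t => (hf' t).continuousAt
  have hint := integrable_of_isBigO_exp_neg (a := 0) one_pos
    (Continuous.continuousOn (by fun_prop))
    (quadratic_form_isBigO hd hd' (derivative P + Q * q) (2 * P + derivative Q + 2 * R * q)
      (Q + derivative R))
  have hlim := (quadratic_form_isBigO hd hd' P Q R).trans_tendsto
    (tendsto_exp_atBot.comp (tendsto_id.const_mul_atTop_of_neg (by norm_num : (-1 : ℝ) < 0)))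
  rw [integral_Ioi_of_hasDerivAt_of_tendsto' hder hint hlim, zero_sub]

end LinearODE

/-! ### The function `D_{-1/2}`: equation, decay and Robin condition -/

theorem alphaHat_spec : alpha = √2 * alphaHat ∧ pcAux (-alpha) = 0 := by
  refine ⟨by rw [alphaHat]; field_simp, ?_⟩
  have h := existsUnique_alpha.choose_spec.1.2
  have hG : Gamma (1 / 2) ≠ 0 := (Gamma_pos_of_pos (by norm_num)).ne'
  change parabolicCylinderDHalf (-alpha) = 0 at h
  rw [congrFun parabolicCylinderDHalf_eq, div_eq_zero_iff, mul_eq_zero] at h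
  simpa only [(exp_pos _).ne', hG, false_or, or_false] using h

theorem pcInt_antitone {p : ℝ} (hp : -1 < p) : Antitone (pcInt p) :=
  antitone_of_deriv_nonpos (fun z => (pcInt_hasDerivAt hp z).differentiableAt) fun z => by
    rw [(pcInt_hasDerivAt hp z).deriv]
    linarith [pcInt_pos (p := p + 1) (by linarith) z]

/-- The function `√π · D_{-1/2}(√2 s)`. -/
noncomputable def pcGauss (s : ℝ) : ℝ := exp (-s ^ 2 / 2) * pcInt (-1 / 2) (√2 * s)

/-- The derivative of `pcGauss`. -/
noncomputable def pcGaussDeriv (s : ℝ) : ℝ :=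
  exp (-s ^ 2 / 2) * (-s * pcInt (-1 / 2) (√2 * s) - √2 * pcInt (1 / 2) (√2 * s))

theorem hasDerivAt_exp_neg_sq_div_two (s : ℝ) :
    HasDerivAt (fun s : ℝ => exp (-s ^ 2 / 2)) (-s * exp (-s ^ 2 / 2)) s := by
  have h1 : HasDerivAt (fun s : ℝ => -s ^ 2 / 2) (-s) s := by
    refine (((hasDerivAt_id s).pow 2).neg.div_const 2).congr_deriv ?_
    simp only [id]
    ring
  exact h1.exp.congr_deriv (by ring)

theorem pcInt_sqrt_two_mul_hasDerivAt {p : ℝ} (hp : -1 < p) (s : ℝ) :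
    HasDerivAt (fun s => pcInt p (√2 * s)) (-√2 * pcInt (p + 1) (√2 * s)) s :=
  ((pcInt_hasDerivAt hp (√2 * s)).comp s ((hasDerivAt_id s).const_mul √2)).congr_deriv (by ring)

theorem pcGauss_hasDerivAt (s : ℝ) : HasDerivAt pcGauss (pcGaussDeriv s) s := by
  have h0 := pcInt_sqrt_two_mul_hasDerivAt (p := -1 / 2) (by norm_num) s
  rw [show (-1 / 2 + 1 : ℝ) = 1 / 2 by norm_num] at h0
  exact ((hasDerivAt_exp_neg_sq_div_two s).mul h0).congr_deriv (by rw [pcGaussDeriv]; ring)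

/-- Differentiating `pcInt (1/2)` brings in `pcInt (3/2)`. By `pcInt_recurrence`, all terms except
`s ^ 2 * pcGauss s` cancel. -/
theorem pcGaussDeriv_hasDerivAt (s : ℝ) : HasDerivAt pcGaussDeriv (s ^ 2 * pcGauss s) s := by
  have h0 := pcInt_sqrt_two_mul_hasDerivAt (p := -1 / 2) (by norm_num) s
  have h1 := pcInt_sqrt_two_mul_hasDerivAt (p := 1 / 2) (by norm_num) s
  rw [show (-1 / 2 + 1 : ℝ) = 1 / 2 by norm_num] at h0
  rw [show (1 / 2 + 1 : ℝ) = 3 / 2 by norm_num] at h1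
  refine ((hasDerivAt_exp_neg_sq_div_two s).mul
    (((hasDerivAt_id s).neg.mul h0).sub (h1.const_mul √2))).congr_deriv ?_
  have hr := pcInt_recurrence (√2 * s)
  have h2 : √2 * √2 = 2 := mul_self_sqrt (by norm_num)
  simp only [pcGauss, id, Pi.sub_apply, Pi.mul_apply, Pi.neg_apply]
  linear_combination (-2 * exp (-s ^ 2 / 2)) * hr
    + exp (-s ^ 2 / 2) * pcInt (3 / 2) (√2 * s) * h2

theorem pcGauss_pos (s : ℝ) : 0 < pcGauss s :=
  mul_pos (exp_pos _) (pcInt_pos (by norm_num) _)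

theorem exp_neg_sub_sq_isBigO (a b : ℝ) :
    (fun t : ℝ => exp (-(t - a) ^ 2 / 2)) =O[atTop] fun t : ℝ => exp (-b * t) := by
  -- The constant comes from completing the square: `(t - a - b)² ≥ 0` gives `-(t - a)²/2 ≤ -b t + a
  -- b + b²/2`.
  refine IsBigO.of_bound (exp (a * b + b ^ 2 / 2)) (Eventually.of_forall fun t => ?_)
  rw [norm_of_nonneg (exp_pos _).le, norm_of_nonneg (exp_pos _).le, ← exp_add]
  exact exp_le_exp.2 (by nlinarith [sq_nonneg (t - a - b)])

theorem pcInt_sqrt_two_mul_sub_isBigO {p : ℝ} (hp : -1 < p) (a : ℝ) :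
    (fun t : ℝ => pcInt p (√2 * (t - a))) =O[atTop] fun _ => (1 : ℝ) := by
  refine IsBigO.of_bound (pcInt p 0) ?_
  filter_upwards [eventually_ge_atTop a] with t ht
  rw [norm_of_nonneg (pcInt_pos hp _).le, norm_one, mul_one]
  exact pcInt_antitone hp (mul_nonneg (sqrt_nonneg 2) (by linarith))

theorem pcGauss_sub_isBigO (a : ℝ) :
    (fun t => pcGauss (t - a)) =O[atTop] fun t : ℝ => exp (-2 * t) := by
  simpa [pcGauss] using (exp_neg_sub_sq_isBigO a 2).mul
    (pcInt_sqrt_two_mul_sub_isBigO (p := -1 / 2) (by norm_num) a)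

theorem pcGaussDeriv_sub_isBigO (a : ℝ) :
    (fun t => pcGaussDeriv (t - a)) =O[atTop] fun t : ℝ => exp (-2 * t) := by
  have h0 := (eval_isBigO_exp (C a - X)).mul
    (pcInt_sqrt_two_mul_sub_isBigO (p := -1 / 2) (by norm_num) a)
  have h1 := (eval_isBigO_exp (C √2)).mul
    (pcInt_sqrt_two_mul_sub_isBigO (p := 1 / 2) (by norm_num) a)
  -- Rate `3` for the Gaussian, because the linear factor `a - t` is charged `e^t`, leaving rate
  -- `2`.
  refine ((exp_neg_sub_sq_isBigO a 3).mul (h0.sub h1)).congr (fun t => ?_) fun t => ?_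
  · simp [pcGaussDeriv]
  · rw [mul_one, ← exp_add]
    ring_nf

/-- This is where `α` enters. With `z = √2 s`, the quantity `pcGaussDeriv s - s * pcGauss s` equals
`-√2 e^{-s²/2} pcAux z`, and `pcAux` vanishes at `z = -α`, that is at `s = -α̂`. -/
theorem pcGaussDeriv_neg_alphaHat :
    pcGaussDeriv (-alphaHat) = -alphaHat * pcGauss (-alphaHat) := by
  obtain ⟨h1, h2⟩ := alphaHat_spec
  rw [pcAux, h1, ← mul_neg] at h2
  rw [pcGaussDeriv, pcGauss]
  have h3 : √2 * √2 = 2 := mul_self_sqrt (by norm_num)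
  linear_combination (-√2 * exp (-(-alphaHat) ^ 2 / 2)) * h2
    - exp (-(-alphaHat) ^ 2 / 2) * alphaHat * pcInt (-1 / 2) (√2 * -alphaHat) * h3

end ParabolicCylinder

/-! ### The normalised function and its moments -/

open ParabolicCylinder Polynomial in
theorem proposition2 :
    ∃ f : SchwartzMap ℝ ℝ,
      ((∀ t : ℝ, 0 < t → 0 < f t) ∧ f 0 = 1) ∧
      (∫ t in Set.Ioi (0 : ℝ),
          (|deriv f t| ^ 2 + (t - ParabolicCylinder.alphaHat) ^ 2 * |f t| ^ 2)
        = ParabolicCylinder.alphaHat) ∧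
      ((∫ t in Set.Ioi (0 : ℝ), (t - ParabolicCylinder.alphaHat) * |f t| ^ 2 = 0) ∧
        (∫ t in Set.Ioi (0 : ℝ), (t - ParabolicCylinder.alphaHat) ^ 2 * |f t| ^ 2
          = ParabolicCylinder.alphaHat / 4) ∧
        (∫ t in Set.Ioi (0 : ℝ), (t - ParabolicCylinder.alphaHat) ^ 3 * |f t| ^ 2
          = 1 / 6 * (1 - 2 * ParabolicCylinder.alphaHat ^ 2))) ∧
      ((∫ t in Set.Ioi (0 : ℝ), deriv f t * f t = -1 / 2) ∧
        (∫ t in Set.Ioi (0 : ℝ), t * |deriv f t| ^ 2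
          = 1 / 3 + ParabolicCylinder.alphaHat ^ 2 / 12)) := by
  set a := alphaHat with ha
  have hN : 0 < pcGauss (-a) := pcGauss_pos _
  set N := pcGauss (-a)
  set g : ℝ → ℝ := fun t => pcGauss (t - a) / N with hg
  set g' : ℝ → ℝ := fun t => pcGaussDeriv (t - a) / N with hg'
  have hd : ∀ t, HasDerivAt g (g' t) t := fun t =>
    ((pcGauss_hasDerivAt (t - a)).comp_sub_const t a).div_const N
  have hd' : ∀ t, HasDerivAt g' (((X - C a) ^ 2 : ℝ[X]).eval t * g t) t := fun t =>
    (((pcGaussDeriv_hasDerivAt (t - a)).comp_sub_const t a).div_const N).congr_deriv (by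
      simp [hg, mul_div_assoc])
  have hO : g =O[Filter.atTop] fun t : ℝ => Real.exp (-2 * t) := by
    simpa [hg, div_eq_inv_mul] using (pcGauss_sub_isBigO a).const_mul_left N⁻¹
  have hO' : g' =O[Filter.atTop] fun t : ℝ => Real.exp (-2 * t) := by
    simpa [hg', div_eq_inv_mul] using (pcGaussDeriv_sub_isBigO a).const_mul_left N⁻¹
  have hg0 : g 0 = 1 := by simp [hg, N, hN.ne']
  have hg'0 : g' 0 = -a := by
    simp only [hg', zero_sub]
    rw [ha, pcGaussDeriv_neg_alphaHat, ← ha, mul_div_assoc, div_self hN.ne', mul_one]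
  obtain ⟨F, hF⟩ := exists_schwartzMap_eqOn_Ici hd hd' hO hO'
  have hF1 : ∀ t, 0 < t → F t = g t := fun t ht => hF ht.le
  -- For `t > 0` the two functions agree on a neighbourhood of `t`, so their derivatives agree; the
  -- endpoint is not needed for the integrals.
  have hF2 : ∀ t, 0 < t → deriv F t = g' t := fun t ht => by
    have : F =ᶠ[nhds t] g := by
      filter_upwards [lt_mem_nhds ht] with s hs using hF1 s hs
    rw [this.deriv_eq, (hd t).deriv]
  -- Reduces each integral to polynomial algebra: exhibit `P`, `Q`, `R` whose differentiated form is
  -- the integrand, then evaluate at `0` with `f(0) = 1` and `f'(0) = -a`.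
  have key : ∀ (P Q R : ℝ[X]) (h : ℝ → ℝ) (v : ℝ),
      (∀ t, 0 < t → h t = (derivative P + Q * (X - C a) ^ 2).eval t * F t ^ 2
        + (2 * P + derivative Q + 2 * R * (X - C a) ^ 2).eval t * (F t * deriv F t)
        + (Q + derivative R).eval t * deriv F t ^ 2) →
      -(P.eval 0 + Q.eval 0 * -a + R.eval 0 * a ^ 2) = v →
      ∫ t in Set.Ioi (0 : ℝ), h t = v := by
    intro P Q R h v hh hv
    have := integral_deriv_quadratic_form hd hd' hO hO' P Q R
    rw [hg0, hg'0] at this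
    rw [← hv, MeasureTheory.setIntegral_congr_fun measurableSet_Ioi fun t ht => ?_, this]
    · ring
    · rw [hh t ht, hF1 t ht, hF2 t ht]
  refine ⟨F, ⟨fun t ht => ?_, (hF (Set.mem_Ici.2 le_rfl)).trans hg0⟩, ?_, ⟨?_, ?_, ?_⟩, ?_, ?_⟩
  · rw [hF1 t ht]
    exact div_pos (pcGauss_pos _) hN
  · refine key 0 1 0 _ _ (fun t _ => ?_) ?_ <;> simp <;> ring
  -- Write `q = (t - a)²`. For an integrand `h f²` the coefficients of `f'²` and `f f'` must vanish,
  -- which forces `Q = -R'` and `P = R''/2 - R q`; what remains is `h = R'''/2 - 2 R' q - R q'`.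
  -- Taking `R = -c (t - a)^k` with `k = 0, 1, 2` yields `h = 2c (t - a)`, `4c (t - a)²`, `6c (t -
  -- a)³`, whence `c = 1/2, 1/4, 1/6` for the three moments.
  · refine key (C (1 / 2) * (X - C a) ^ 2) 0 (-C (1 / 2)) _ _ (fun t _ => ?_) ?_ <;>
      simp [derivative_pow, -mul_eq_mul_right_iff]
  · refine key (C (1 / 4) * (X - C a) ^ 3) (C (1 / 4)) (-C (1 / 4) * (X - C a)) _ _
      (fun t _ => ?_) ?_ <;>
      simp [derivative_pow] <;> ring
  · refine key (C (1 / 6) * ((X - C a) ^ 4 - 1)) (C (1 / 3) * (X - C a))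
      (-C (1 / 6) * (X - C a) ^ 2) _ _ (fun t _ => ?_) ?_ <;>
      simp [derivative_pow] <;> ring
  · refine key (C (1 / 2)) 0 0 _ _ (fun t _ => ?_) ?_ <;> simp <;> ring
  -- Here the `f'²` coefficient must be `t`, so `Q = t - R'` and `P = -Q'/2 - R q`. Splitting `t =
  -- (t - a) + a`, the condition `P' + Q q = 0` on the `f²` coefficient is met by `R = (t - a)²/6 +
  -- a (t - a)/4`, one term for each summand.
  · refine key (C (-1 / 3) - C (1 / 6) * (X - C a) ^ 4 - C (a / 4) * (X - C a) ^ 3)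
      (C (2 / 3) * (X - C a) + C (3 * a / 4))
      (C (1 / 6) * (X - C a) ^ 2 + C (a / 4) * (X - C a)) _ _ (fun t _ => ?_) ?_ <;>
      simp [derivative_pow] <;> ring
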